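/- For a Lebesgue measurable set $F\subset\mathbb R^n$ let $\operatorname{Per}(F)=\sup\{\int_F\operatorname{div}\varphi\,dx:\varphi\in C^1_c(\mathbb R^n;\mathbb R^n),\ |\varphi|\le 1\}\in[0,\infty]$ be its perimeter, and for $E\subset\mathbb R^n$ let $d_E$ be the signed distance function to $E$ ($d_E=\operatorname{dist}(\cdot,E)$ outside $E$, $d_E=-\operatorname{dist}(\cdot,\mathbb R^n\setminus E)$ inside $E$, with $\operatorname{dist}(\cdot,\emptyset)=+\infty$). A set $E\subset\mathbb R^n$ is called a minimizing hull if $|\partial E|=0$ and $\operatorname{Per}(E)\le\operatorname{Per}(F)$ for every $F\supset E$ with $F\setminus E$ compact. For $h>0$, a set $E$ and an obstacle $\Omega\subset E$, consider the problem of minimizing $$\operatorname{Per}(F)+\frac1h\int_{F\Delta E}|d_E|\,dx$$ among all Lebesgue measurable sets $F\supset\Omega$; a minimizer is a set $F$ at which the minimum is attained and finite, and the maximal minimizer, denoted $E_h$, is the minimizer that contains every other minimizer up to Lebesgue null sets (it is unique up to null sets). Let $h>0$, let $\Omega^1\subset\Omega^2\subset\mathbb R^n$ be two obstacles, and let $E^1\subset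 E^2$ be two minimizing hulls with $\Omega^1\subset E^1$ and $\Omega^2\subset E^2$. Let $E^1_h$ and $E^2_h$ be the maximal minimizers of the above problem for $(\Omega,E)=(\Omega^1,E^1)$ and $(\Omega,E)=(\Omega^2,E^2)$ respectively. Then $E^1_h\subset E^2_h$ up to a Lebesgue null set. -/

import Mathlib

open MeasureTheory
open scoped ENNReal symmDiff

noncomputable section

/-- The divergence `∑ᵢ ∂ᵢ φᵢ` of a vector field on `ℝⁿ`. -/
def divergence {n : ℕ} (φ : EuclideanSpace ℝ (Fin n) → EuclideanSpace ℝ (Fin n))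
    (x : EuclideanSpace ℝ (Fin n)) : ℝ :=
  ∑ i : Fin n, (fderiv ℝ φ x (EuclideanSpace.single i 1)) i

/-- The (De Giorgi) perimeter of a Lebesgue measurable set `F ⊆ ℝⁿ`: the supremum of `∫_F div φ`
over compactly supported `C¹` vector fields `φ` with `|φ| ≤ 1`; it may be `∞`. -/
def perimeter {n : ℕ} (F : Set (EuclideanSpace ℝ (Fin n))) : ℝ≥0∞ :=
  ⨆ (φ : EuclideanSpace ℝ (Fin n) → EuclideanSpace ℝ (Fin n))
    (_ : ContDiff ℝ 1 φ ∧ HasCompactSupport φ ∧ ∀ x, ‖φ x‖ ≤ 1),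
    ENNReal.ofReal (∫ x in F, divergence φ x)

/-- The signed distance function `d_E`: `dist(x, E)` outside `E` and `-dist(x, Eᶜ)` inside `E`.
At every point at least one of the two terms vanishes. The distance to the empty set is `∞`, so that
`d_∅ = ∞` and `d_{ℝⁿ} = -∞`. -/
def setSignedDist {n : ℕ} (E : Set (EuclideanSpace ℝ (Fin n))) (x : EuclideanSpace ℝ (Fin n)) :
    EReal :=
  (Metric.infEDist x E : EReal) - (Metric.infEDist x Eᶜ : EReal)

/-- `E` is a minimizing hull: `|∂E| = 0` and `Per(E) ≤ Per(F)` for all `F ⊇ E` with `F \ E` compact.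
The first condition makes `E`, and hence every such `F`, Lebesgue measurable. -/
def IsMinimizingHull {n : ℕ} (E : Set (EuclideanSpace ℝ (Fin n))) : Prop :=
  volume (frontier E) = 0 ∧
    ∀ F : Set (EuclideanSpace ℝ (Fin n)), E ⊆ F → IsCompact (F \ E) → perimeter E ≤ perimeter F

/-- The functional `F ↦ Per(F) + (1/h) ∫_{F Δ E} |d_E|` of the minimizing scheme with step `h`. -/
def schemeEnergy {n : ℕ} (h : ℝ) (E F : Set (EuclideanSpace ℝ (Fin n))) : ℝ≥0∞ :=
  perimeter F + ENNReal.ofReal (1 / h) * ∫⁻ x in F ∆ E, (setSignedDist E x).abs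

/-- `F` solves one step of the scheme from `E` with obstacle `Ω`: among the Lebesgue measurable sets
that contain `Ω`, it minimizes the functional, with a finite minimum. (If `Ω ⊆ E` and `E` has finite
perimeter, the minimum is at most `Per(E)`, hence finite.) -/
def IsSchemeMinimizer {n : ℕ} (h : ℝ) (Ω E F : Set (EuclideanSpace ℝ (Fin n))) : Prop :=
  NullMeasurableSet F ∧ Ω ⊆ F ∧ schemeEnergy h E F ≠ ∞ ∧
    ∀ G : Set (EuclideanSpace ℝ (Fin n)), NullMeasurableSet G → Ω ⊆ G →
      schemeEnergy h E F ≤ schemeEnergy h E G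

/-- `F` is the maximal minimizer: a minimizer that contains every other one. As usual for sets of
finite perimeter, this is meant up to Lebesgue null sets (which do not change the functional). -/
def IsMaximalSchemeMinimizer {n : ℕ} (h : ℝ) (Ω E F : Set (EuclideanSpace ℝ (Fin n))) : Prop :=
  IsSchemeMinimizer h Ω E F ∧
    ∀ G : Set (EuclideanSpace ℝ (Fin n)), IsSchemeMinimizer h Ω E G → G ≤ᵐ[volume] F

end

/-!
For `E₁ ⊆ E₂` the two energies satisfy the crossed submodularity inequality
`𝓔₁(F₁ ∩ F₂) + 𝓔₂(F₁ ∪ F₂) ≤ 𝓔₁(F₁) + 𝓔₂(F₂)`. Since `F₁` is optimal against the competitor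
`F₁ ∩ F₂` and `𝓔₁(F₁)` is finite, `F₁ ∪ F₂` is a minimizer for `E₂`, and hence contained in the
maximal one.

The distance term is `∫_{F Δ E} |d_E| = ∫_F dist(·, E) + ∫_{Fᶜ} dist(·, Eᶜ)`, whose integrands are
respectively decreasing and increasing in `E`.

The perimeter of a set is the total variation of its indicator function, so its submodularity is
an instance of `|D max(f, g)| + |D min(f, g)| ≤ |Df| + |Dg|`, which by mollification need only be
shown for `C¹` functions. Replacing `max(f, g) = g + (f - g)⁺` and `min(f, g) = f - (f - g)⁺` by
`g + p(f - g)` and `f - p(f - g)`, with `p` a smooth nondecreasing `1`-Lipschitz function close to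
the positive part, the inequality follows by recombining the two test fields convexly with weight
`p'(f - g)`.
-/

open Filter Set Topology
open ContinuousLinearMap (lsmul)
open scoped Convolution

/-- The vector fields over which the supremum in the definition of `perimeter` is taken. -/
structure IsTestField {n : ℕ} (φ : EuclideanSpace ℝ (Fin n) → EuclideanSpace ℝ (Fin n)) : Prop where
  contDiff : ContDiff ℝ 1 φ
  hasCompactSupport : HasCompactSupport φ
  norm_le_one : ∀ x, ‖φ x‖ ≤ 1

/-- The total variation `|Du|(ℝⁿ)` of a locally integrable function `u : ℝⁿ → ℝ`, defined by duality
so that the perimeter of a set is the total variation of its indicator function. -/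
noncomputable def totalVariation {n : ℕ} (u : EuclideanSpace ℝ (Fin n) → ℝ) : ℝ≥0∞ :=
  ⨆ (φ : EuclideanSpace ℝ (Fin n) → EuclideanSpace ℝ (Fin n)) (_ : IsTestField φ),
    ENNReal.ofReal (∫ x, u x * divergence φ x)

section Divergence

variable {n : ℕ} {φ : EuclideanSpace ℝ (Fin n) → EuclideanSpace ℝ (Fin n)}
  {f : EuclideanSpace ℝ (Fin n) → ℝ}

lemma continuous_divergence (hφ : ContDiff ℝ 1 φ) : Continuous (divergence φ) := by
  have : Continuous (fderiv ℝ φ) := hφ.continuous_fderiv one_ne_zero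
  unfold divergence
  fun_prop

lemma hasCompactSupport_divergence (hφ : HasCompactSupport φ) :
    HasCompactSupport (divergence φ) :=
  (hφ.fderiv (𝕜 := ℝ)).mono fun x hx h0 => hx (by simp [divergence, h0])

lemma integrable_divergence (hφ : ContDiff ℝ 1 φ) (hc : HasCompactSupport φ) :
    Integrable (divergence φ) :=
  (continuous_divergence hφ).integrable_of_hasCompactSupport (hasCompactSupport_divergence hc)

lemma divergence_neg : divergence (-φ) = -divergence φ := by
  ext x
  simp [divergence, fderiv_neg]

lemma divergence_comp_add_right (t x : EuclideanSpace ℝ (Fin n)) :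
    divergence (fun y => φ (y + t)) x = divergence φ (x + t) := by
  simp only [divergence, fderiv_comp_add_right]

lemma divergence_eq_sum_fderiv_apply (hφ : Differentiable ℝ φ) (x : EuclideanSpace ℝ (Fin n)) :
    divergence φ x = ∑ i, fderiv ℝ (fun y => φ y i) x (EuclideanSpace.single i 1) := by
  refine Finset.sum_congr rfl fun i _ => ?_
  have := ((EuclideanSpace.proj (𝕜 := ℝ) i).hasFDerivAt.comp x (hφ x).hasFDerivAt).fderiv
  exact (DFunLike.congr_fun this (EuclideanSpace.single i 1)).symm

lemma fderiv_apply_eq_sum_mul (x v : EuclideanSpace ℝ (Fin n)) :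
    fderiv ℝ f x v = ∑ i, fderiv ℝ f x (EuclideanSpace.single i 1) * v i := by
  have hv : v = ∑ i, v i • EuclideanSpace.single i (1 : ℝ) := by
    ext j
    simp [Pi.single_apply]
  conv_lhs => rw [hv]
  simp [mul_comm]

lemma integrable_fderiv_apply (hf : ContDiff ℝ 1 f) (hφ : Continuous φ)
    (hc : HasCompactSupport φ) : Integrable fun x => fderiv ℝ f x (φ x) := by
  have hf' : Continuous (fderiv ℝ f) := hf.continuous_fderiv one_ne_zero
  refine (hf'.clm_apply hφ).integrable_of_hasCompactSupport (hc.mono fun x hx h0 => hx ?_)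
  simp [h0]

theorem integral_mul_divergence (hf : ContDiff ℝ 1 f) (hφ : ContDiff ℝ 1 φ)
    (hc : HasCompactSupport φ) :
    ∫ x, f x * divergence φ x = -∫ x, fderiv ℝ f x (φ x) := by
  have hφi (i : Fin n) : ContDiff ℝ 1 fun x => φ x i := by fun_prop
  have hci (i : Fin n) : HasCompactSupport fun x => φ x i :=
    hc.comp_left (g := fun v : EuclideanSpace ℝ (Fin n) => v i) rfl
  have hf' : Continuous (fderiv ℝ f) := hf.continuous_fderiv one_ne_zero
  have hφ' (i : Fin n) : Continuous (fderiv ℝ fun x => φ x i) :=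
    (hφi i).continuous_fderiv one_ne_zero
  have hf'φ (i : Fin n) :
      Integrable fun x => fderiv ℝ f x (EuclideanSpace.single i 1) * φ x i :=
    ((hf'.clm_apply continuous_const).mul (hφi i).continuous).integrable_of_hasCompactSupport
      (hci i).mul_left
  have hfφ' (i : Fin n) :
      Integrable fun x => f x * fderiv ℝ (fun y => φ y i) x (EuclideanSpace.single i 1) :=
    (hf.continuous.mul ((hφ' i).clm_apply continuous_const)).integrable_of_hasCompactSupport
      ((hci i).fderiv_apply ℝ _).mul_left
  simp only [divergence_eq_sum_fderiv_apply (hφ.differentiable one_ne_zero),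
    fderiv_apply_eq_sum_mul _ (φ _), Finset.mul_sum]
  rw [integral_finsetSum _ fun i _ => hfφ' i, integral_finsetSum _ fun i _ => hf'φ i,
    ← Finset.sum_neg_distrib]
  refine Finset.sum_congr rfl fun i _ => ?_
  exact integral_mul_fderiv_eq_neg_fderiv_mul_of_integrable (hf'φ i) (hfφ' i)
    ((hf.continuous.mul (hφi i).continuous).integrable_of_hasCompactSupport (hci i).mul_left)
    (fun x _ => hf.differentiable one_ne_zero x) fun x _ => (hφi i).differentiable one_ne_zero x

end Divergence

namespace IsTestField

variable {n : ℕ} {φ ψ : EuclideanSpace ℝ (Fin n) → EuclideanSpace ℝ (Fin n)}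

lemma zero : IsTestField (0 : EuclideanSpace ℝ (Fin n) → EuclideanSpace ℝ (Fin n)) :=
  ⟨contDiff_const, HasCompactSupport.zero, by simp⟩

lemma neg (hφ : IsTestField φ) : IsTestField (-φ) :=
  ⟨hφ.contDiff.neg, hφ.hasCompactSupport.neg, by simpa using hφ.norm_le_one⟩

lemma comp_add_right (hφ : IsTestField φ) (t : EuclideanSpace ℝ (Fin n)) :
    IsTestField fun x => φ (x + t) :=
  ⟨hφ.contDiff.comp (contDiff_id.add contDiff_const),
    hφ.hasCompactSupport.comp_homeomorph (Homeomorph.addRight t), fun x => hφ.norm_le_one (x + t)⟩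

lemma convexCombination (hφ : IsTestField φ) (hψ : IsTestField ψ)
    {χ : EuclideanSpace ℝ (Fin n) → ℝ} (hχ : ContDiff ℝ 1 χ) (h01 : ∀ x, χ x ∈ Icc (0 : ℝ) 1) :
    IsTestField fun x => χ x • φ x + (1 - χ x) • ψ x where
  contDiff := (hχ.smul hφ.contDiff).add ((contDiff_const.sub hχ).smul hψ.contDiff)
  hasCompactSupport := (hφ.hasCompactSupport.mono fun x hx h0 => hx (by simp [h0])).add
    (hψ.hasCompactSupport.mono fun x hx h0 => hx (by simp [h0]))
  norm_le_one x := by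
    have hball := convex_closedBall (0 : EuclideanSpace ℝ (Fin n)) 1
      (mem_closedBall_zero_iff.2 (hφ.norm_le_one x)) (mem_closedBall_zero_iff.2 (hψ.norm_le_one x))
      (h01 x).1 (sub_nonneg.2 (h01 x).2) (add_sub_cancel _ _)
    exact mem_closedBall_zero_iff.1 hball

end IsTestField

section TotalVariation

variable {n : ℕ} {φ ψ : EuclideanSpace ℝ (Fin n) → EuclideanSpace ℝ (Fin n)}
  {u v : EuclideanSpace ℝ (Fin n) → ℝ}

lemma ofReal_integral_mul_divergence_le_totalVariation (hφ : IsTestField φ) :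
    ENNReal.ofReal (∫ x, u x * divergence φ x) ≤ totalVariation u :=
  le_iSup₂_of_le φ hφ le_rfl

lemma exists_isTestField_integral_mul_divergence_eq_abs (u : EuclideanSpace ℝ (Fin n) → ℝ)
    (hφ : IsTestField φ) :
    ∃ ψ, IsTestField ψ ∧ ∫ x, u x * divergence ψ x = |∫ x, u x * divergence φ x| := by
  rcases abs_choice (∫ x, u x * divergence φ x) with h | h
  · exact ⟨φ, hφ, h.symm⟩
  · exact ⟨-φ, hφ.neg, by simp [h, divergence_neg, integral_neg]⟩

lemma enorm_integral_mul_divergence_le_totalVariation (hφ : IsTestField φ) :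
    ‖∫ x, u x * divergence φ x‖ₑ ≤ totalVariation u := by
  obtain ⟨ψ, hψ, h⟩ := exists_isTestField_integral_mul_divergence_eq_abs u hφ
  rw [Real.enorm_eq_ofReal_abs, ← h]
  exact ofReal_integral_mul_divergence_le_totalVariation hψ

/-- Both fields may be replaced by fields with nonnegative pairing, so no positive part is lost when
the two suprema are added. -/
lemma totalVariation_add_totalVariation_le {c : ℝ≥0∞}
    (h : ∀ φ ψ, IsTestField φ → IsTestField ψ →
      ENNReal.ofReal ((∫ x, u x * divergence φ x) + ∫ x, v x * divergence ψ x) ≤ c) :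
    totalVariation u + totalVariation v ≤ c := by
  refine ENNReal.biSup_add_biSup_le' ⟨0, .zero⟩ ⟨0, .zero⟩ fun φ hφ ψ hψ => ?_
  obtain ⟨φ', hφ', eφ⟩ := exists_isTestField_integral_mul_divergence_eq_abs u hφ
  obtain ⟨ψ', hψ', eψ⟩ := exists_isTestField_integral_mul_divergence_eq_abs v hψ
  calc ENNReal.ofReal (∫ x, u x * divergence φ x) + ENNReal.ofReal (∫ x, v x * divergence ψ x)
      ≤ ENNReal.ofReal |∫ x, u x * divergence φ x|
        + ENNReal.ofReal |∫ x, v x * divergence ψ x| := by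
        gcongr <;> exact le_abs_self _
    _ = ENNReal.ofReal ((∫ x, u x * divergence φ' x) + ∫ x, v x * divergence ψ' x) := by
        rw [eφ, eψ, ENNReal.ofReal_add (abs_nonneg _) (abs_nonneg _)]
    _ ≤ c := h φ' ψ' hφ' hψ'

lemma tendsto_integral_mul_divergence {ι : Type*} {l : Filter ι} [l.IsCountablyGenerated]
    {F : ι → EuclideanSpace ℝ (Fin n) → ℝ} {b : EuclideanSpace ℝ (Fin n) → ℝ}
    (hF : ∀ᶠ i in l, AEStronglyMeasurable (F i)) (hb : LocallyIntegrable b)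
    (hFb : ∀ᶠ i in l, ∀ᵐ x, |F i x| ≤ b x)
    (hlim : ∀ᵐ x, Tendsto (fun i => F i x) l (𝓝 (u x))) (hφ : ContDiff ℝ 1 φ)
    (hc : HasCompactSupport φ) :
    Tendsto (fun i => ∫ x, F i x * divergence φ x) l (𝓝 (∫ x, u x * divergence φ x)) := by
  have hdiv := continuous_divergence hφ
  have hbdiv : Integrable fun x => b x * |divergence φ x| :=
    hb.integrable_smul_right_of_hasCompactSupport hdiv.abs
      ((hasCompactSupport_divergence hc).comp_left abs_zero)
  refine tendsto_integral_filter_of_dominated_convergence _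
    (hF.mono fun i hi => hi.mul hdiv.aestronglyMeasurable) (hFb.mono fun i hi => ?_) hbdiv
    (hlim.mono fun x hx => hx.mul_const _)
  filter_upwards [hi] with x hx
  rw [Real.norm_eq_abs, abs_mul]
  gcongr

lemma tendsto_integral_mul_divergence_of_tendstoUniformly {ι : Type*} {l : Filter ι}
    [l.IsCountablyGenerated] {F : ι → EuclideanSpace ℝ (Fin n) → ℝ}
    (hF : ∀ᶠ i in l, AEStronglyMeasurable (F i)) (hu : LocallyIntegrable u)
    (hFu : TendstoUniformly F u l) (hφ : ContDiff ℝ 1 φ) (hc : HasCompactSupport φ) :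
    Tendsto (fun i => ∫ x, F i x * divergence φ x) l (𝓝 (∫ x, u x * divergence φ x)) := by
  have hb : LocallyIntegrable fun x => |u x| + 1 :=
    LocallyIntegrable.add (fun x => (hu x).norm) (locallyIntegrable_const 1)
  refine tendsto_integral_mul_divergence hF hb ?_ (.of_forall fun x => hFu.tendsto_at x) hφ hc
  filter_upwards [Metric.tendstoUniformly_iff.1 hFu 1 one_pos] with i hi
  refine .of_forall fun x => ?_
  have h1 := hi x
  rw [dist_comm, Real.dist_eq] at h1
  linarith [abs_sub_abs_le_abs_sub (F i x) (u x)]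

theorem totalVariation_add_totalVariation_le_of_tendsto {ι : Type*} {l : Filter ι} [l.NeBot]
    {F G : ι → EuclideanSpace ℝ (Fin n) → ℝ} {c : ℝ≥0∞}
    (hF : ∀ φ, IsTestField φ →
      Tendsto (fun i => ∫ x, F i x * divergence φ x) l (𝓝 (∫ x, u x * divergence φ x)))
    (hG : ∀ φ, IsTestField φ →
      Tendsto (fun i => ∫ x, G i x * divergence φ x) l (𝓝 (∫ x, v x * divergence φ x)))
    (hc : ∀ᶠ i in l, totalVariation (F i) + totalVariation (G i) ≤ c) :
    totalVariation u + totalVariation v ≤ c := by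
  refine totalVariation_add_totalVariation_le fun φ ψ hφ hψ => ?_
  refine le_of_tendsto (ENNReal.tendsto_ofReal ((hF φ hφ).add (hG ψ hψ))) (hc.mono fun i hi => ?_)
  calc ENNReal.ofReal ((∫ x, F i x * divergence φ x) + ∫ x, G i x * divergence ψ x)
      ≤ ENNReal.ofReal (∫ x, F i x * divergence φ x)
        + ENNReal.ofReal (∫ x, G i x * divergence ψ x) := ENNReal.ofReal_add_le
    _ ≤ totalVariation (F i) + totalVariation (G i) :=
        add_le_add (ofReal_integral_mul_divergence_le_totalVariation hφ)
          (ofReal_integral_mul_divergence_le_totalVariation hψ)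
    _ ≤ c := hi

end TotalVariation

section SmoothPositivePart

/-- A smooth approximation of the positive part `t ↦ max t 0` at scale `δ`, obtained from
`max t 0 = (t + |t|) / 2` by smoothing `|t| = √(t²)`. -/
noncomputable def smoothPosPart (δ t : ℝ) : ℝ := (t + √(t ^ 2 + δ ^ 2)) / 2

variable {δ : ℝ}

lemma contDiff_smoothPosPart {m : WithTop ℕ∞} (hδ : δ ≠ 0) : ContDiff ℝ m (smoothPosPart δ) := by
  have (t : ℝ) : t ^ 2 + δ ^ 2 ≠ 0 := by positivity
  unfold smoothPosPart
  fun_prop (disch := assumption)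

lemma hasDerivAt_smoothPosPart (hδ : δ ≠ 0) (t : ℝ) :
    HasDerivAt (smoothPosPart δ) ((1 + t / √(t ^ 2 + δ ^ 2)) / 2) t := by
  have hpos : t ^ 2 + δ ^ 2 ≠ 0 := by positivity
  have hsqrt : HasDerivAt (fun s => √(s ^ 2 + δ ^ 2)) (t / √(t ^ 2 + δ ^ 2)) t := by
    convert ((hasDerivAt_pow 2 t).add_const (δ ^ 2)).sqrt hpos using 1
    simp [mul_div_mul_left]
  exact ((hasDerivAt_id t).add hsqrt).div_const 2

lemma deriv_smoothPosPart_mem_Icc (hδ : δ ≠ 0) (t : ℝ) :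
    deriv (smoothPosPart δ) t ∈ Icc (0 : ℝ) 1 := by
  have hle : |t / √(t ^ 2 + δ ^ 2)| ≤ 1 := by
    rw [abs_div, abs_of_nonneg (Real.sqrt_nonneg _)]
    exact div_le_one_of_le₀ (Real.abs_le_sqrt (by nlinarith)) (Real.sqrt_nonneg _)
  rw [(hasDerivAt_smoothPosPart hδ t).deriv]
  constructor <;> linarith [abs_le.1 hle]

lemma abs_smoothPosPart_sub_max_le (δ t : ℝ) : |smoothPosPart δ t - max t 0| ≤ |δ| := by
  have hlower : |t| ≤ √(t ^ 2 + δ ^ 2) := Real.abs_le_sqrt (by nlinarith)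
  have hupper : √(t ^ 2 + δ ^ 2) ≤ |t| + |δ| := by
    rw [Real.sqrt_le_left (by positivity), add_sq, sq_abs, sq_abs]
    nlinarith [mul_nonneg (abs_nonneg t) (abs_nonneg δ)]
  have hmax : max t 0 = (t + |t|) / 2 := by
    rcases le_total 0 t with h | h
    · rw [max_eq_left h, abs_of_nonneg h]; ring
    · rw [max_eq_right h, abs_of_nonpos h]; ring
  rw [hmax, smoothPosPart, abs_le]
  constructor <;> linarith [abs_nonneg δ]

lemma tendstoUniformly_smoothPosPart :
    TendstoUniformly smoothPosPart (fun t => max t 0) (𝓝 0) := by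
  refine Metric.tendstoUniformly_iff.2 fun ε hε => ?_
  filter_upwards [Metric.ball_mem_nhds 0 hε] with δ hδ t
  rw [dist_comm, Real.dist_eq]
  exact (abs_smoothPosPart_sub_max_le δ t).trans_lt (by simpa using hδ)

end SmoothPositivePart

section Submodularity

variable {n : ℕ} {f g u v : EuclideanSpace ℝ (Fin n) → ℝ}

/-- With `χ = p' ∘ (f - g)`, the fields `χ φ + (1 - χ) ψ` and `χ ψ + (1 - χ) φ` have the same total
pairing with `f` and `g` as `φ` and `ψ` have with the two functions on the left-hand side. -/
lemma totalVariation_add_comp_sub_add_totalVariation_sub_comp_sub_le {p : ℝ → ℝ}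
    (hf : ContDiff ℝ 1 f) (hg : ContDiff ℝ 1 g) (hp : ContDiff ℝ 2 p)
    (hp01 : ∀ t, deriv p t ∈ Icc (0 : ℝ) 1) :
    totalVariation (fun x => g x + p (f x - g x)) + totalVariation (fun x => f x - p (f x - g x))
      ≤ totalVariation f + totalVariation g := by
  refine totalVariation_add_totalVariation_le fun φ ψ hφ hψ => ?_
  have hp' : ContDiff ℝ 1 (deriv p) := (contDiff_succ_iff_deriv.1 hp).2.2
  have hpfg : ContDiff ℝ 1 fun x => p (f x - g x) := (hp.of_le one_le_two).comp (hf.sub hg)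
  have hχ : ContDiff ℝ 1 fun x => deriv p (f x - g x) := hp'.comp (hf.sub hg)
  have hfd := hf.differentiable one_ne_zero
  have hgd := hg.differentiable one_ne_zero
  have hfderiv (x) : fderiv ℝ (fun y => p (f y - g y)) x
      = deriv p (f x - g x) • (fderiv ℝ f x - fderiv ℝ g x) :=
    (((hp.differentiable two_ne_zero _).hasDerivAt).comp_hasFDerivAt x
      ((hfd x).hasFDerivAt.sub (hgd x).hasFDerivAt)).fderiv
  have hint {k ξ} (hk : ContDiff ℝ 1 k) (hξ : IsTestField ξ) :
      Integrable fun x : EuclideanSpace ℝ (Fin n) => fderiv ℝ k x (ξ x) :=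
    integrable_fderiv_apply hk hξ.contDiff.continuous hξ.hasCompactSupport
  have hibp {k ξ} (hk : ContDiff ℝ 1 k) (hξ : IsTestField ξ) :
      ∫ x : EuclideanSpace ℝ (Fin n), k x * divergence ξ x = -∫ x, fderiv ℝ k x (ξ x) :=
    integral_mul_divergence hk hξ.contDiff hξ.hasCompactSupport
  have hΦ := hφ.convexCombination hψ hχ fun x => hp01 _
  have hΨ := hψ.convexCombination hφ hχ fun x => hp01 _
  calc ENNReal.ofReal ((∫ x, (g x + p (f x - g x)) * divergence φ x)
        + ∫ x, (f x - p (f x - g x)) * divergence ψ x)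
      = ENNReal.ofReal ((∫ x, f x * divergence _ x) + ∫ x, g x * divergence _ x) := by
        rw [hibp (hg.add hpfg) hφ, hibp (hf.sub hpfg) hψ, hibp hf hΦ, hibp hg hΨ, ← neg_add,
          ← neg_add, ← integral_add (hint (hg.add hpfg) hφ) (hint (hf.sub hpfg) hψ),
          ← integral_add (hint hf hΦ) (hint hg hΨ)]
        congr! 4 with x
        rw [fderiv_fun_add (hgd x) (hpfg.differentiable one_ne_zero x),
          fderiv_fun_sub (hfd x) (hpfg.differentiable one_ne_zero x), hfderiv]
        simp only [add_apply, sub_apply, smul_apply, map_add, map_smul, smul_eq_mul]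
        ring
    _ ≤ totalVariation f + totalVariation g := ENNReal.ofReal_add_le.trans <|
        add_le_add (ofReal_integral_mul_divergence_le_totalVariation hΦ)
          (ofReal_integral_mul_divergence_le_totalVariation hΨ)

lemma add_max_sub_zero_eq_max (a b : ℝ) : b + max (a - b) 0 = max a b := by
  rw [← max_add_add_left, add_sub_cancel, add_zero]

lemma sub_max_sub_zero_eq_min (a b : ℝ) : a - max (a - b) 0 = min a b := by
  linarith [add_max_sub_zero_eq_max a b, max_add_min a b]

lemma totalVariation_max_add_totalVariation_min_le_of_contDiff (hf : ContDiff ℝ 1 f)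
    (hg : ContDiff ℝ 1 g) :
    totalVariation (fun x => max (f x) (g x)) + totalVariation (fun x => min (f x) (g x))
      ≤ totalVariation f + totalVariation g := by
  have hδ0 : ∀ᶠ δ : ℝ in 𝓝[≠] 0, δ ≠ 0 := self_mem_nhdsWithin
  have hcont : ∀ᶠ δ in 𝓝[≠] 0, Continuous fun x => smoothPosPart δ (f x - g x) :=
    hδ0.mono fun δ hδ => (contDiff_smoothPosPart (m := 0) hδ).continuous.comp
      (hf.continuous.sub hg.continuous)
  have hlim : TendstoUniformly (fun δ x => smoothPosPart δ (f x - g x))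
      (fun x => max (f x - g x) 0) (𝓝[≠] 0) := fun s hs =>
    nhdsWithin_le_nhds (tendstoUniformly_smoothPosPart.comp (fun x => f x - g x) s hs)
  simp only [← add_max_sub_zero_eq_max (f _), ← sub_max_sub_zero_eq_min]
  refine totalVariation_add_totalVariation_le_of_tendsto (l := 𝓝[≠] (0 : ℝ))
    (fun φ hφ => tendsto_integral_mul_divergence_of_tendstoUniformly
      (hcont.mono fun δ hδ => (hg.continuous.add hδ).aestronglyMeasurable)
      (by fun_prop : Continuous _).locallyIntegrable ?_ hφ.contDiff hφ.hasCompactSupport)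
    (fun φ hφ => tendsto_integral_mul_divergence_of_tendstoUniformly
      (hcont.mono fun δ hδ => (hf.continuous.sub hδ).aestronglyMeasurable)
      (by fun_prop : Continuous _).locallyIntegrable ?_ hφ.contDiff hφ.hasCompactSupport)
    (hδ0.mono fun δ hδ => totalVariation_add_comp_sub_add_totalVariation_sub_comp_sub_le hf hg
      (contDiff_smoothPosPart hδ) (deriv_smoothPosPart_mem_Icc hδ))
  · simpa only [Metric.tendstoUniformly_iff, Pi.add_apply, dist_add_left] using hlim
  · simpa only [Metric.tendstoUniformly_iff, Pi.sub_apply, dist_sub_left] using hlim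

end Submodularity

section Mollification

variable {n : ℕ} {φ : EuclideanSpace ℝ (Fin n) → EuclideanSpace ℝ (Fin n)}
  {k u v : EuclideanSpace ℝ (Fin n) → ℝ} {C : ℝ}

lemma locallyIntegrable_of_abs_le (hu : AEStronglyMeasurable u) (huC : ∀ x, |u x| ≤ C) :
    LocallyIntegrable u :=
  (locallyIntegrable_const C).mono hu (.of_forall fun x => (huC x).trans (le_abs_self C))

lemma integral_convolution_mul_divergence (hk : Integrable k) (hu : AEStronglyMeasurable u)
    (huC : ∀ x, |u x| ≤ C) (hφ : ContDiff ℝ 1 φ) (hc : HasCompactSupport φ) :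
    ∫ x, (k ⋆[lsmul ℝ ℝ, volume] u) x * divergence φ x
      = ∫ t, k t * ∫ x, u x * divergence (fun y => φ (y + t)) x := by
  have hu_sub : AEStronglyMeasurable
      (fun p : EuclideanSpace ℝ (Fin n) × EuclideanSpace ℝ (Fin n) => u (p.1 - p.2))
      (volume.prod volume) :=
    hu.comp_quasiMeasurePreserving
      (quasiMeasurePreserving_sub_of_right_invariant volume volume)
  have hint : Integrable (fun p : EuclideanSpace ℝ (Fin n) × EuclideanSpace ℝ (Fin n) =>
      u (p.1 - p.2) * (divergence φ p.1 * k p.2)) (volume.prod volume) :=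
    ((integrable_divergence hφ hc).mul_prod hk).bdd_mul hu_sub (.of_forall fun p => huC _)
  calc ∫ x, (k ⋆[lsmul ℝ ℝ, volume] u) x * divergence φ x
      = ∫ x, ∫ t, u (x - t) * (divergence φ x * k t) := by
        congr! 2
        rw [convolution, ← integral_mul_const]
        congr! 2
        simp only [ContinuousLinearMap.lsmul_apply, smul_eq_mul]
        ring
    _ = ∫ t, ∫ x, u (x - t) * (divergence φ x * k t) := integral_integral_swap hint
    _ = ∫ t, k t * ∫ x, u x * divergence (fun y => φ (y + t)) x := by
        congr! 2 with t
        rw [← integral_const_mul, ← integral_add_right_eq_self _ t]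
        congr! 2
        rw [add_sub_cancel_right, divergence_comp_add_right]
        ring

theorem totalVariation_convolution_le (hk : Integrable k) (hu : AEStronglyMeasurable u)
    (huC : ∀ x, |u x| ≤ C) :
    totalVariation (k ⋆[lsmul ℝ ℝ, volume] u) ≤ (∫⁻ t, ‖k t‖ₑ) * totalVariation u := by
  refine iSup₂_le fun φ hφ => ?_
  rw [integral_convolution_mul_divergence hk hu huC hφ.contDiff hφ.hasCompactSupport]
  calc ENNReal.ofReal (∫ t, k t * ∫ x, u x * divergence (fun y => φ (y + t)) x)
      ≤ ‖∫ t, k t * ∫ x, u x * divergence (fun y => φ (y + t)) x‖ₑ := by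
        rw [Real.enorm_eq_ofReal_abs]
        exact ENNReal.ofReal_le_ofReal (le_abs_self _)
    _ ≤ ∫⁻ t, ‖k t * ∫ x, u x * divergence (fun y => φ (y + t)) x‖ₑ :=
        enorm_integral_le_lintegral_enorm _
    _ ≤ ∫⁻ t, ‖k t‖ₑ * totalVariation u := lintegral_mono fun t => by
        rw [enorm_mul]
        gcongr
        exact enorm_integral_mul_divergence_le_totalVariation (hφ.comp_add_right t)
    _ = (∫⁻ t, ‖k t‖ₑ) * totalVariation u := lintegral_mul_const'' _ hk.1.enorm

lemma totalVariation_mollification_le (ρ : ContDiffBump (0 : EuclideanSpace ℝ (Fin n)))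
    (hu : AEStronglyMeasurable u) (huC : ∀ x, |u x| ≤ C) :
    totalVariation (ρ.normed volume ⋆[lsmul ℝ ℝ, volume] u) ≤ totalVariation u := by
  refine (totalVariation_convolution_le ρ.integrable_normed hu huC).trans_eq ?_
  have hmass : ∫⁻ t, ‖ρ.normed volume t‖ₑ = 1 := by
    simp only [Real.enorm_of_nonneg (ρ.nonneg_normed _)]
    rw [← ofReal_integral_eq_lintegral_ofReal ρ.integrable_normed
      (.of_forall fun t => ρ.nonneg_normed t), ρ.integral_normed, ENNReal.ofReal_one]
  rw [hmass, one_mul]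

lemma contDiff_mollification (ρ : ContDiffBump (0 : EuclideanSpace ℝ (Fin n)))
    (hu : LocallyIntegrable u) : ContDiff ℝ 1 (ρ.normed volume ⋆[lsmul ℝ ℝ, volume] u) :=
  ρ.hasCompactSupport_normed.contDiff_convolution_left (n := 1) _ ρ.contDiff_normed hu

lemma abs_mollification_le (ρ : ContDiffBump (0 : EuclideanSpace ℝ (Fin n)))
    (huC : ∀ x, |u x| ≤ C) (x : EuclideanSpace ℝ (Fin n)) :
    |(ρ.normed volume ⋆[lsmul ℝ ℝ, volume] u) x| ≤ C := by
  calc |(ρ.normed volume ⋆[lsmul ℝ ℝ, volume] u) x|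
      ≤ ∫ t, ρ.normed volume t * C := by
        rw [← Real.norm_eq_abs]
        refine norm_integral_le_of_norm_le (ρ.integrable_normed.mul_const C)
          (.of_forall fun t => ?_)
        have hρ := ρ.nonneg_normed (μ := volume) t
        rw [ContinuousLinearMap.lsmul_apply, norm_smul, Real.norm_of_nonneg hρ]
        exact mul_le_mul_of_nonneg_left (huC _) hρ
    _ = C := by rw [integral_mul_const, ρ.integral_normed, one_mul]

theorem totalVariation_max_add_totalVariation_min_le (hu : AEStronglyMeasurable u)
    (hv : AEStronglyMeasurable v) (huC : ∀ x, |u x| ≤ C) (hvC : ∀ x, |v x| ≤ C) :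
    totalVariation (fun x => max (u x) (v x)) + totalVariation (fun x => min (u x) (v x))
      ≤ totalVariation u + totalVariation v := by
  let ρ (k : ℕ) : ContDiffBump (0 : EuclideanSpace ℝ (Fin n)) :=
    ⟨1 / (k + 1), 2 * (1 / (k + 1)), by positivity, lt_two_mul_self (by positivity)⟩
  have hρ : Tendsto (fun k => (ρ k).rOut) atTop (𝓝 0) := by
    simpa [ρ] using tendsto_one_div_add_atTop_nhds_zero_nat.const_mul (2 : ℝ)
  have huL := locallyIntegrable_of_abs_le hu huC
  have hvL := locallyIntegrable_of_abs_le hv hvC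
  have hu_lim := ContDiffBump.ae_convolution_tendsto_right_of_locallyIntegrable (μ := volume) hρ
    (.of_forall fun k => le_rfl) huL
  have hv_lim := ContDiffBump.ae_convolution_tendsto_right_of_locallyIntegrable (μ := volume) hρ
    (.of_forall fun k => le_rfl) hvL
  have hu_cont (k) := (contDiff_mollification (ρ k) huL).continuous
  have hv_cont (k) := (contDiff_mollification (ρ k) hvL).continuous
  refine totalVariation_add_totalVariation_le_of_tendsto
    (fun φ hφ => tendsto_integral_mul_divergence
      (.of_forall fun k => ((hu_cont k).max (hv_cont k)).aestronglyMeasurable)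
      (locallyIntegrable_const C) (.of_forall fun k => .of_forall fun x => ?_)
      (by filter_upwards [hu_lim, hv_lim] with x hx hy using hx.max hy)
      hφ.contDiff hφ.hasCompactSupport)
    (fun φ hφ => tendsto_integral_mul_divergence
      (.of_forall fun k => ((hu_cont k).min (hv_cont k)).aestronglyMeasurable)
      (locallyIntegrable_const C) (.of_forall fun k => .of_forall fun x => ?_)
      (by filter_upwards [hu_lim, hv_lim] with x hx hy using hx.min hy)
      hφ.contDiff hφ.hasCompactSupport)
    (.of_forall fun k => (totalVariation_max_add_totalVariation_min_le_of_contDiff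
      (contDiff_mollification (ρ k) huL) (contDiff_mollification (ρ k) hvL)).trans
      (add_le_add (totalVariation_mollification_le _ hu huC)
        (totalVariation_mollification_le _ hv hvC)))
  · exact abs_max_le_max_abs_abs.trans
      (max_le (abs_mollification_le _ huC x) (abs_mollification_le _ hvC x))
  · exact abs_min_le_max_abs_abs.trans
      (max_le (abs_mollification_le _ huC x) (abs_mollification_le _ hvC x))

end Mollification

section Perimeter

variable {n : ℕ} {A B : Set (EuclideanSpace ℝ (Fin n))}

lemma perimeter_eq_totalVariation_indicator (hA : NullMeasurableSet A) :
    perimeter A = totalVariation (A.indicator 1) := by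
  have hint (φ : EuclideanSpace ℝ (Fin n) → EuclideanSpace ℝ (Fin n)) :
      ∫ x, A.indicator 1 x * divergence φ x = ∫ x in A, divergence φ x := by
    rw [← integral_indicator₀ hA]
    simp only [← indicator_mul_left, Pi.one_apply, one_mul]
  have hiff (φ : EuclideanSpace ℝ (Fin n) → EuclideanSpace ℝ (Fin n)) :
      IsTestField φ ↔ ContDiff ℝ 1 φ ∧ HasCompactSupport φ ∧ ∀ x, ‖φ x‖ ≤ 1 :=
    ⟨fun ⟨h₁, h₂, h₃⟩ => ⟨h₁, h₂, h₃⟩, fun ⟨h₁, h₂, h₃⟩ => ⟨h₁, h₂, h₃⟩⟩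
  simp only [perimeter, totalVariation, hint, hiff]

theorem perimeter_union_add_perimeter_inter_le (hA : NullMeasurableSet A)
    (hB : NullMeasurableSet B) :
    perimeter (A ∪ B) + perimeter (A ∩ B) ≤ perimeter A + perimeter B := by
  have hmeas {S : Set (EuclideanSpace ℝ (Fin n))} (hS : NullMeasurableSet S) :
      AEStronglyMeasurable (S.indicator (1 : EuclideanSpace ℝ (Fin n) → ℝ)) :=
    aestronglyMeasurable_one.indicator₀ hS
  have hbound (S : Set (EuclideanSpace ℝ (Fin n))) (x) : |S.indicator 1 x| ≤ (1 : ℝ) := by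
    by_cases hx : x ∈ S <;> simp [hx]
  have hmax : (A ∪ B).indicator (1 : EuclideanSpace ℝ (Fin n) → ℝ)
      = fun x => max (A.indicator 1 x) (B.indicator 1 x) := by
    ext x
    by_cases hA : x ∈ A <;> by_cases hB : x ∈ B <;> simp [hA, hB]
  have hmin : (A ∩ B).indicator (1 : EuclideanSpace ℝ (Fin n) → ℝ)
      = fun x => min (A.indicator 1 x) (B.indicator 1 x) := by
    ext x
    by_cases hA : x ∈ A <;> by_cases hB : x ∈ B <;> simp [hA, hB]
  rw [perimeter_eq_totalVariation_indicator (hA.union hB),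
    perimeter_eq_totalVariation_indicator (hA.inter hB), perimeter_eq_totalVariation_indicator hA,
    perimeter_eq_totalVariation_indicator hB, hmax, hmin]
  exact totalVariation_max_add_totalVariation_min_le (hmeas hA) (hmeas hB) (hbound A) (hbound B)

end Perimeter

section DistanceTerm

lemma setLIntegral_inter_add_setLIntegral_union_le {α : Type*} [MeasurableSpace α] {μ : Measure α}
    {f g : α → ℝ≥0∞} {A B : Set α} (hgf : g ≤ f) (hB : NullMeasurableSet B μ) :
    (∫⁻ x in A ∩ B, f x ∂μ) + ∫⁻ x in A ∪ B, g x ∂μ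
      ≤ (∫⁻ x in A, f x ∂μ) + ∫⁻ x in B, g x ∂μ :=
  calc (∫⁻ x in A ∩ B, f x ∂μ) + ∫⁻ x in A ∪ B, g x ∂μ
      ≤ (∫⁻ x in A ∩ B, f x ∂μ) + ((∫⁻ x in A \ B, f x ∂μ) + ∫⁻ x in B, g x ∂μ) := by
        rw [← sdiff_union_self]
        gcongr
        exact (lintegral_union_le _ _ _).trans (by gcongr; exact hgf _)
    _ = (∫⁻ x in A, f x ∂μ) + ∫⁻ x in B, g x ∂μ := by
        rw [← add_assoc, ← lintegral_add_measure, Measure.restrict_inter_add_sdiff₀ A hB]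

lemma setLIntegral_infEDist_sdiff {α : Type*} [PseudoEMetricSpace α] [MeasurableSpace α]
    [OpensMeasurableSpace α] (μ : Measure α) (S E : Set α) :
    ∫⁻ x in S \ E, Metric.infEDist x E ∂μ = ∫⁻ x in S, Metric.infEDist x E ∂μ := by
  refine le_antisymm (lintegral_mono_set sdiff_subset) ?_
  have hzero : ∫⁻ x in S ∩ closure E, Metric.infEDist x E ∂μ = 0 := by
    refine le_antisymm ((lintegral_mono_set inter_subset_right).trans_eq ?_) zero_le
    rw [setLIntegral_congr_fun isClosed_closure.measurableSet
      fun x hx => Metric.mem_closure_iff_infEDist_zero.1 hx, lintegral_zero]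
  rw [← lintegral_inter_add_sdiff _ S isClosed_closure.measurableSet, hzero, zero_add]
  exact lintegral_mono_set (sdiff_subset_sdiff_right subset_closure)

lemma abs_coe_ennreal_ereal (a : ℝ≥0∞) : (a : EReal).abs = a := by
  cases a with
  | top => rfl
  | coe a => exact (EReal.abs_def a).trans (by simp)

variable {n : ℕ} {E₁ E₂ F₁ F₂ : Set (EuclideanSpace ℝ (Fin n))}

lemma abs_setSignedDist (E : Set (EuclideanSpace ℝ (Fin n))) (x : EuclideanSpace ℝ (Fin n)) :
    (setSignedDist E x).abs = Metric.infEDist x E + Metric.infEDist x Eᶜ := by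
  by_cases hx : x ∈ E
  · simp [setSignedDist, Metric.infEDist_zero_of_mem hx, abs_coe_ennreal_ereal]
  · simp [setSignedDist, Metric.infEDist_zero_of_mem (mem_compl hx), abs_coe_ennreal_ereal]

lemma setLIntegral_symmDiff_abs_setSignedDist (E F : Set (EuclideanSpace ℝ (Fin n))) :
    ∫⁻ x in F ∆ E, (setSignedDist E x).abs
      = (∫⁻ x in F, Metric.infEDist x E) + ∫⁻ x in Fᶜ, Metric.infEDist x Eᶜ := by
  have hE : F ∆ E \ E = F \ E := by ext; grind
  have hEc : F ∆ E \ Eᶜ = Fᶜ \ Eᶜ := by ext; grind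
  simp only [abs_setSignedDist]
  rw [lintegral_add_left Metric.continuous_infEDist.measurable,
    ← setLIntegral_infEDist_sdiff _ _ E, ← setLIntegral_infEDist_sdiff _ _ Eᶜ, hE, hEc,
    setLIntegral_infEDist_sdiff, setLIntegral_infEDist_sdiff]

lemma setLIntegral_symmDiff_abs_setSignedDist_inter_add_union_le (hE : E₁ ⊆ E₂)
    (hF₁ : NullMeasurableSet F₁) (hF₂ : NullMeasurableSet F₂) :
    (∫⁻ x in (F₁ ∩ F₂) ∆ E₁, (setSignedDist E₁ x).abs)
        + ∫⁻ x in (F₁ ∪ F₂) ∆ E₂, (setSignedDist E₂ x).abs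
      ≤ (∫⁻ x in F₁ ∆ E₁, (setSignedDist E₁ x).abs)
        + ∫⁻ x in F₂ ∆ E₂, (setSignedDist E₂ x).abs := by
  have hinside := setLIntegral_inter_add_setLIntegral_union_le (A := F₁)
    (fun x => Metric.infEDist_anti (x := x) hE) hF₂
  have houtside := setLIntegral_inter_add_setLIntegral_union_le (A := F₂ᶜ)
    (fun x => Metric.infEDist_anti (x := x) (compl_subset_compl.2 hE)) hF₁.compl
  simp only [setLIntegral_symmDiff_abs_setSignedDist, compl_inter, compl_union]
  rw [inter_comm F₁ᶜ, union_comm F₁ᶜ, add_add_add_comm, add_comm (∫⁻ x in F₂ᶜ ∪ F₁ᶜ, _),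
    add_add_add_comm (∫⁻ x in F₁, _), add_comm (∫⁻ x in F₁ᶜ, _)]
  exact add_le_add hinside houtside

end DistanceTerm

section Comparison

variable {n : ℕ} {h : ℝ} {Ω₁ Ω₂ E₁ E₂ F₁ F₂ : Set (EuclideanSpace ℝ (Fin n))}

theorem schemeEnergy_inter_add_schemeEnergy_union_le (h : ℝ) (hE : E₁ ⊆ E₂)
    (hF₁ : NullMeasurableSet F₁) (hF₂ : NullMeasurableSet F₂) :
    schemeEnergy h E₁ (F₁ ∩ F₂) + schemeEnergy h E₂ (F₁ ∪ F₂)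
      ≤ schemeEnergy h E₁ F₁ + schemeEnergy h E₂ F₂ := by
  have hperimeter := perimeter_union_add_perimeter_inter_le hF₁ hF₂
  have hdistance := setLIntegral_symmDiff_abs_setSignedDist_inter_add_union_le hE hF₁ hF₂
  unfold schemeEnergy
  rw [add_add_add_comm, ← mul_add, add_add_add_comm (perimeter F₁), ← mul_add,
    add_comm (perimeter (F₁ ∩ F₂))]
  gcongr

theorem IsSchemeMinimizer.union (hF₁ : IsSchemeMinimizer h Ω₁ E₁ F₁)
    (hF₂ : IsSchemeMinimizer h Ω₂ E₂ F₂) (hΩ : Ω₁ ⊆ Ω₂) (hE : E₁ ⊆ E₂) :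
    IsSchemeMinimizer h Ω₂ E₂ (F₁ ∪ F₂) := by
  obtain ⟨hm₁, hΩF₁, hfin₁, hmin₁⟩ := hF₁
  obtain ⟨hm₂, hΩF₂, hfin₂, hmin₂⟩ := hF₂
  have hinter : schemeEnergy h E₁ F₁ ≤ schemeEnergy h E₁ (F₁ ∩ F₂) :=
    hmin₁ _ (hm₁.inter hm₂) (subset_inter hΩF₁ (hΩ.trans hΩF₂))
  have hunion : schemeEnergy h E₂ (F₁ ∪ F₂) ≤ schemeEnergy h E₂ F₂ :=
    (ENNReal.add_le_add_iff_left hfin₁).1 <| (add_le_add_left hinter _).trans <|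
      schemeEnergy_inter_add_schemeEnergy_union_le h hE hm₁ hm₂
  exact ⟨hm₁.union hm₂, hΩF₂.trans subset_union_right, ne_top_of_le_ne_top hfin₂ hunion,
    fun G hG hΩG => hunion.trans (hmin₂ G hG hΩG)⟩

end Comparison

theorem mainTheorem8_general {n : ℕ} {h : ℝ} (_hh : 0 < h)
    {Ω₁ Ω₂ E₁ E₂ F₁ F₂ : Set (EuclideanSpace ℝ (Fin n))} (hΩ : Ω₁ ⊆ Ω₂) (hE : E₁ ⊆ E₂)
    (hF₁ : IsSchemeMinimizer h Ω₁ E₁ F₁) (hF₂ : IsMaximalSchemeMinimizer h Ω₂ E₂ F₂) :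
    F₁ ≤ᵐ[volume] F₂ :=
  subset_union_left.eventuallyLE.trans (hF₂.2 _ (hF₁.union hF₂.1 hΩ hE))

theorem mainTheorem8 (n : ℕ) (h : ℝ) (hh : 0 < h)
    (Ω₁ Ω₂ E₁ E₂ F₁ F₂ : Set (EuclideanSpace ℝ (Fin n)))
    (hΩ : Ω₁ ⊆ Ω₂) (hE : E₁ ⊆ E₂) (hΩE₁ : Ω₁ ⊆ E₁) (hΩE₂ : Ω₂ ⊆ E₂)
    (hull₁ : IsMinimizingHull E₁) (hull₂ : IsMinimizingHull E₂)
    (hF₁ : IsMaximalSchemeMinimizer h Ω₁ E₁ F₁) (hF₂ : IsMaximalSchemeMinimizer h Ω₂ E₂ F₂) :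
    F₁ ≤ᵐ[volume] F₂ :=
  mainTheorem8_general hh hΩ hE hF₁.1 hF₂
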